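/- Let $n\ge 2$ be an integer and let $X$ be a random variable with values in $\{0,1,\dots,n\}$, with mean $\mu$, standard deviation $\sigma>0$ and probability generating function $f_X(z)=\sum_{k=0}^{n}\mathbb{P}(X=k)\,z^k$. Put $X^{*}=(X-\mu)/\sigma$. Let $\delta\in(0,1)$ be such that $|1-\zeta|\ge\delta$ for every complex root $\zeta$ of $f_X$. Then $$\sup_{t\in\mathbb{R}}\bigl|\mathbb{P}(X^{*}\le t)-\mathbb{P}(Z\le t)\bigr| = O\!\left(\frac{\log n}{\delta\sigma}\right),$$ where $Z\sim N(0,1)$ is a standard normal random variable and the implicit constant is absolute (it does not depend on $n$, $X$ or $\delta$) and can be taken to be $2^{3261}$. -/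

import Mathlib

open MeasureTheory ProbabilityTheory

noncomputable section

/-- The probability generating function `f_X(z) = ∑_{k=0}^{n} P(X = k) z^k` of a random variable
`X` with values in `{0, …, n}`, as a polynomial over `ℂ`. -/
def pgf {Ω : Type*} [MeasurableSpace Ω] (P : Measure Ω) (n : ℕ) (X : Ω → ℕ) : Polynomial ℂ :=
  ∑ k ∈ Finset.range (n + 1), Polynomial.monomial k ((P.real {ω | X ω = k} : ℝ) : ℂ)

/-- The mean `μ = E X`. -/
def mean {Ω : Type*} [MeasurableSpace Ω] (P : Measure Ω) (X : Ω → ℕ) : ℝ :=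
  ∫ ω, (X ω : ℝ) ∂P

/-- The standard deviation `σ = √(Var X)`. -/
def stdDev {Ω : Type*} [MeasurableSpace Ω] (P : Measure Ω) (X : Ω → ℕ) : ℝ :=
  Real.sqrt (variance (fun ω => (X ω : ℝ)) P)

/-- The normalized random variable `X* = (X - μ) / σ`. -/
def normalized {Ω : Type*} [MeasurableSpace Ω] (P : Measure Ω) (X : Ω → ℕ) : Ω → ℝ :=
  fun ω => ((X ω : ℝ) - mean P X) / stdDev P X

/-- The Kolmogorov distance `sup_t |ν₁((-∞, t]) - ν₂((-∞, t])|` of two laws on `ℝ`. For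
probability measures the supremum is over a nonempty set of reals bounded by `1`. -/
def kolmogorovDist (ν₁ ν₂ : Measure ℝ) : ℝ :=
  ⨆ t : ℝ, |ν₁.real (Set.Iic t) - ν₂.real (Set.Iic t)|

end

/-! Write M(w) = E exp(wX) = f_X(exp w). The roots of f_X stay at distance δ from 1, so M has no
zero on |w| < δ/4 and φ = log M is holomorphic there. Let g = φ'; then g(0) = μ and g'(0) = σ². The
aim is to compare φ with μw + σ²w²/2 on a disk of radius of order δ / log n.

Positivity of the probabilities gives |M(w)| ≤ M(Re w): on each vertical line Re φ is largest at the
real axis. Comparing Re φ with its reflection in a line Im z = b, through a minimum principle on a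
rectangle, shows that ∂_y Re φ = -Im g is almost nonpositive on that line
(`neg_le_im_deriv_of_re_le`). The error is sup|g|, at most 3n/δ, times an exponential that beats n
once b ≤ r = δ/(64 log n). This is where log n comes from.

Thus g is almost typically real on |z| = r: real on the real axis, with imaginary part almost
nonnegative above it. For such functions g'(0) controls the remainder after the linear term
(`norm_sub_sub_le_of_im_nonneg`). Integrating, φ differs from its quadratic part by at most
12σ²|w|³/r (`exists_log_momentSum_approx`). Hence the characteristic function of X* is close to
exp(-t²/2) for 0 < t ≤ T = rσ/48, and Esseen's inequality (`abs_cdf_sub_cdf_le`) bounds the distance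
by 132/T. -/

/-! ### The Fejér kernel -/

/-- The Fejér kernel `k(v) = ∫₀¹ (1 - t) cos (t v) dt`. -/
noncomputable def fejerKernel (v : ℝ) : ℝ := ∫ t in (0:ℝ)..1, (1 - t) * Real.cos (t * v)

lemma fejerKernel_eq {v : ℝ} (hv : v ≠ 0) : fejerKernel v = (1 - Real.cos v) / v ^ 2 := by
  have h : ∀ t ∈ Set.uIcc (0:ℝ) 1, HasDerivAt
      (fun t : ℝ => (1 - t) * (Real.sin (t * v) / v) - Real.cos (t * v) / v ^ 2)
      ((1 - t) * Real.cos (t * v)) t := by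
    intro t _
    have h0 : HasDerivAt (fun t : ℝ => t * v) v t := by simpa using (hasDerivAt_id t).mul_const v
    have h1 := h0.sin.div_const v
    have h2 := h0.cos.div_const (v ^ 2)
    have h3 := (((hasDerivAt_id t).const_sub 1).mul h1).sub h2
    refine h3.congr_deriv ?_
    simp only [id]
    field_simp
    ring
  rw [fejerKernel, intervalIntegral.integral_eq_sub_of_hasDerivAt h]
  · simp; ring
  · exact Continuous.intervalIntegrable (by fun_prop) _ _

lemma fejerKernel_neg (v : ℝ) : fejerKernel (-v) = fejerKernel v := by
  simp [fejerKernel]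

lemma fejerKernel_nonneg (v : ℝ) : 0 ≤ fejerKernel v := by
  by_cases hv : v = 0
  · subst hv
    refine intervalIntegral.integral_nonneg zero_le_one fun t ht => ?_
    simp [ht.2]
  · rw [fejerKernel_eq hv]
    have := Real.cos_le_one v
    have : 0 ≤ 1 - Real.cos v := by linarith
    positivity

lemma continuous_fejerKernel : Continuous fejerKernel := by
  unfold fejerKernel
  exact intervalIntegral.continuous_parametric_intervalIntegral_of_continuous' (by fun_prop) 0 1

lemma integral_one_sub_zero_one : ∫ t in (0:ℝ)..1, (1 - t) = 1 / 2 := by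
  rw [intervalIntegral.integral_sub (by simp) (by simp)]
  simp; norm_num

lemma fejerKernel_le_one (v : ℝ) : fejerKernel v ≤ 1 := by
  have : fejerKernel v ≤ ∫ t in (0:ℝ)..1, (1 - t) := by
    refine intervalIntegral.integral_mono_on zero_le_one
      (Continuous.intervalIntegrable (by fun_prop) _ _)
      (Continuous.intervalIntegrable (by fun_prop) _ _) fun t ht => ?_
    have := Real.cos_le_one (t * v)
    nlinarith [ht.2]
  rw [integral_one_sub_zero_one] at this
  linarith

lemma fejerKernel_le (v : ℝ) (hv : v ≠ 0) : fejerKernel v ≤ 2 / v ^ 2 := by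
  rw [fejerKernel_eq hv]
  have := Real.neg_one_le_cos v
  gcongr
  linarith

lemma fejerKernel_ge (v : ℝ) (hv : |v| ≤ 1) : 1 / 4 ≤ fejerKernel v := by
  have : ∫ t in (0:ℝ)..1, (1 - t) * (1 / 2) ≤ fejerKernel v := by
    refine intervalIntegral.integral_mono_on zero_le_one
      (Continuous.intervalIntegrable (by fun_prop) _ _)
      (Continuous.intervalIntegrable (by fun_prop) _ _) fun t ht => ?_
    have h1 := Real.one_sub_sq_div_two_le_cos (x := t * v)
    have h2 : (t * v) ^ 2 ≤ 1 := by
      rw [mul_pow, ← sq_abs v]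
      have : t ^ 2 ≤ 1 := pow_le_one₀ ht.1 ht.2
      have : |v| ^ 2 ≤ 1 := pow_le_one₀ (abs_nonneg _) hv
      nlinarith [sq_nonneg t, sq_nonneg |v|]
    have : 0 ≤ 1 - t := by linarith [ht.2]
    exact mul_le_mul_of_nonneg_left (by linarith) this
  rw [intervalIntegral.integral_mul_const, integral_one_sub_zero_one] at this
  linarith

lemma integrable_fejerKernel : Integrable fejerKernel := by
  refine (integrable_inv_one_add_sq.const_mul 4).mono'
    continuous_fejerKernel.aestronglyMeasurable (ae_of_all _ fun v => ?_)
  rw [Real.norm_of_nonneg (fejerKernel_nonneg v)]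
  have h1 := fejerKernel_le_one v
  rw [← div_eq_mul_inv, le_div_iff₀ (by positivity)]
  by_cases hv : v = 0
  · subst hv; linarith
  · have h2 := fejerKernel_le v hv
    rw [le_div_iff₀ (by positivity)] at h2
    linarith

lemma setIntegral_fejerKernel_Ioi_le {h : ℝ} (hh : 0 < h) :
    ∫ v in Set.Ioi h, fejerKernel v ≤ 2 / h := by
  have hi : IntegrableOn (fun v : ℝ => v ^ (-2 : ℝ)) (Set.Ioi h) :=
    integrableOn_Ioi_rpow_of_lt (by norm_num) hh
  calc ∫ v in Set.Ioi h, fejerKernel v ≤ ∫ v in Set.Ioi h, 2 * v ^ (-2 : ℝ) := by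
        refine setIntegral_mono_on integrable_fejerKernel.integrableOn (hi.const_mul 2)
          measurableSet_Ioi fun v hv => ?_
        have hv0 : 0 < v := hh.trans hv
        rw [Real.rpow_neg hv0.le, Real.rpow_two, ← div_eq_mul_inv]
        exact fejerKernel_le v hv0.ne'
    _ = 2 / h := by
        rw [integral_const_mul, integral_Ioi_rpow_of_lt (by norm_num) hh]
        norm_num
        rw [Real.rpow_neg hh.le, Real.rpow_one]; rfl

lemma setIntegral_fejerKernel_compl_le {h : ℝ} (hh : 0 < h) :
    ∫ v in (Set.Icc (-h) h)ᶜ, fejerKernel v ≤ 4 / h := by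
  have hc : (Set.Icc (-h) h)ᶜ = Set.Iio (-h) ∪ Set.Ioi h := by
    ext v; simp only [Set.mem_compl_iff, Set.mem_Icc, Set.mem_union, Set.mem_Iio, Set.mem_Ioi]
    rw [not_and_or, not_le, not_le]
  have hneg : ∫ v in Set.Iio (-h), fejerKernel v = ∫ v in Set.Ioi h, fejerKernel v := by
    rw [← integral_Iic_eq_integral_Iio]
    have := integral_comp_neg_Ioi h fejerKernel
    simp only [fejerKernel_neg] at this
    exact this.symm
  rw [hc, setIntegral_union _ measurableSet_Ioi integrable_fejerKernel.integrableOn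
    integrable_fejerKernel.integrableOn, hneg]
  · have := setIntegral_fejerKernel_Ioi_le hh
    have h4 : 4 / h = 2 / h + 2 / h := by ring
    linarith
  · rw [Set.disjoint_left]
    intro v hv hv'
    simp only [Set.mem_Iio, Set.mem_Ioi] at hv hv'
    linarith

lemma half_le_setIntegral_fejerKernel {h : ℝ} (hh : 1 ≤ h) :
    1 / 2 ≤ ∫ v in Set.Icc (-h) h, fejerKernel v := by
  calc (1:ℝ) / 2 = ∫ v in Set.Icc (-1:ℝ) 1, (1 / 4 : ℝ) := by
        simp; norm_num
    _ ≤ ∫ v in Set.Icc (-1:ℝ) 1, fejerKernel v := by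
        refine setIntegral_mono_on (by simp) integrable_fejerKernel.integrableOn
          measurableSet_Icc fun v hv => fejerKernel_ge v (abs_le.2 hv)
    _ ≤ _ := by
        refine setIntegral_mono_set integrable_fejerKernel.integrableOn
          (ae_of_all _ fun v => fejerKernel_nonneg v) (Set.Icc_subset_Icc ?_ hh).eventuallyLE
        linarith

/-! ### Smoothing and Esseen's inequality -/

/-- Fubini. The Fourier transform of the kernel lives on [-1, 1], so smoothing sees the
characteristic function only there. -/
lemma integral_fejerKernel_sub (ν : Measure ℝ) [IsProbabilityMeasure ν] (s : ℝ) :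
    ∫ x, fejerKernel (x - s) ∂ν =
      ∫ t in (0:ℝ)..1, (1 - t) * (Complex.exp (-(t * s) * Complex.I) * charFun ν t).re := by
  have hi : Integrable (Function.uncurry fun t x : ℝ => (1 - t) * Real.cos (t * (x - s)))
      ((volume.restrict (Set.uIoc 0 1)).prod ν) := by
    refine Integrable.mono' (g := fun _ => 1) (by simp) (by fun_prop) ?_
    have h : ∀ᵐ z ∂((volume.restrict (Set.uIoc (0:ℝ) 1)).prod ν), z.1 ∈ Set.uIoc (0:ℝ) 1 :=
      Measure.quasiMeasurePreserving_fst.ae (ae_restrict_mem measurableSet_uIoc)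
    filter_upwards [h] with z hz
    rw [Set.uIoc_of_le zero_le_one] at hz
    simp only [Function.uncurry, norm_mul, Real.norm_eq_abs]
    rw [abs_of_nonneg (by linarith [hz.2])]
    have := Real.abs_cos_le_one (z.1 * (z.2 - s))
    nlinarith [abs_nonneg (Real.cos (z.1 * (z.2 - s))), hz.1, hz.2]
  unfold fejerKernel
  rw [← intervalIntegral_integral_swap hi]
  refine intervalIntegral.integral_congr fun t _ => ?_
  rw [integral_const_mul, charFun_apply_real,
    ← integral_const_mul (Complex.exp (-(t * s) * Complex.I)),
    ← RCLike.re_eq_complex_re, ← integral_re]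
  · congr 1
    refine integral_congr_ae (ae_of_all _ fun x => ?_)
    simp only [RCLike.re_eq_complex_re]
    rw [← Complex.exp_add, ← Complex.exp_ofReal_mul_I_re]
    congr 2
    push_cast
    ring
  · refine Integrable.const_mul ?_ _
    refine Integrable.mono' (g := fun _ => 1) (by simp) (by fun_prop) (ae_of_all _ fun x => ?_)
    rw [← Complex.ofReal_mul, Complex.norm_exp_ofReal_mul_I]

lemma intervalIntegral_integral_fejerKernel (ν : Measure ℝ) [IsProbabilityMeasure ν] {b a : ℝ}
    (hba : b ≤ a) :
    ∫ s in b..a, ∫ x, fejerKernel (x - s) ∂ν =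
      ∫ v, fejerKernel v * ν.real (Set.Ioc (v + b) (v + a)) := by
  have hk := continuous_fejerKernel
  have hi : Integrable (Function.uncurry fun s x : ℝ => fejerKernel (x - s))
      ((volume.restrict (Set.uIoc b a)).prod ν) := by
    rw [Set.uIoc_of_le hba]
    refine Integrable.mono' (g := fun _ => 1) (integrable_const _) (by fun_prop) (ae_of_all _ fun z => ?_)
    simp only [Function.uncurry]
    rw [Real.norm_of_nonneg (fejerKernel_nonneg _)]
    exact fejerKernel_le_one _
  rw [intervalIntegral_integral_swap hi]
  have h1 : ∀ x : ℝ, ∫ s in b..a, fejerKernel (x - s) =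
      ∫ v, fejerKernel v * (Set.Ioc (v + b) (v + a)).indicator 1 x := by
    intro x
    rw [intervalIntegral.integral_of_le hba, ← integral_indicator measurableSet_Ioc,
      ← integral_sub_left_eq_self _ volume x]
    refine integral_congr_ae (ae_of_all _ fun v => ?_)
    simp only [Set.indicator_apply, Set.mem_Ioc, Pi.one_apply]
    have : (b < x - v ∧ x - v ≤ a) ↔ (v + b < x ∧ x ≤ v + a) := by
      constructor <;> rintro ⟨h, h'⟩ <;> constructor <;> linarith
    simp only [this, sub_sub_cancel]
    split_ifs <;> simp
  simp_rw [h1]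
  rw [integral_integral_swap]
  · refine integral_congr_ae (ae_of_all _ fun v => ?_)
    simp only
    rw [integral_const_mul, integral_indicator_one measurableSet_Ioc]
  · refine Integrable.mono' (g := fun z => fejerKernel z.2)
      (integrable_fejerKernel.comp_snd ν) ?_ (ae_of_all _ fun z => ?_)
    · have hm : MeasurableSet {z : ℝ × ℝ | z.2 + b < z.1 ∧ z.1 ≤ z.2 + a} :=
        (measurableSet_lt (f := fun z : ℝ × ℝ => z.2 + b) (g := fun z => z.1)
          (by fun_prop) (by fun_prop)).inter
          (measurableSet_le (f := fun z : ℝ × ℝ => z.1) (g := fun z => z.2 + a)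
            (by fun_prop) (by fun_prop))
      have : (Function.uncurry fun x v : ℝ =>
          fejerKernel v * (Set.Ioc (v + b) (v + a)).indicator 1 x) =
          fun z : ℝ × ℝ => fejerKernel z.2 *
            {z : ℝ × ℝ | z.2 + b < z.1 ∧ z.1 ≤ z.2 + a}.indicator 1 z := by
        ext z
        simp [Function.uncurry, Set.indicator_apply]
      rw [this]
      exact ((hk.comp continuous_snd).measurable.mul
        (measurable_one.indicator hm)).aestronglyMeasurable
    · simp only [Function.uncurry, norm_mul, Set.indicator_apply, Pi.one_apply]
      rw [Real.norm_of_nonneg (fejerKernel_nonneg _)]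
      have := fejerKernel_nonneg z.2
      split_ifs <;> simp [this]

/-- Integrating exp(-its) over s first gains a factor 2/t, which cancels the t in the hypothesis.
The bound is uniform in the interval, so b can later tend to -∞. -/
lemma abs_intervalIntegral_sub_le (ν γ : Measure ℝ) [IsProbabilityMeasure ν]
    [IsProbabilityMeasure γ] {β : ℝ → ℝ} (hβ : IntervalIntegrable β volume 0 1)
    (h : ∀ t ∈ Set.Ioc (0:ℝ) 1, ‖charFun ν t - charFun γ t‖ ≤ t * β t) (b a : ℝ) :
    |(∫ s in b..a, ∫ x, fejerKernel (x - s) ∂ν) - ∫ s in b..a, ∫ x, fejerKernel (x - s) ∂γ| ≤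
      2 * ∫ t in (0:ℝ)..1, β t := by
  have hc1 : Continuous (charFun ν) := continuous_charFun
  have hc2 : Continuous (charFun γ) := continuous_charFun
  have hcont : Continuous fun p : ℝ × ℝ => (1 - p.2) *
      (Complex.exp (-(p.2 * p.1) * Complex.I) * (charFun ν p.2 - charFun γ p.2)).re := by
    fun_prop
  have hc : ∀ (μ : Measure ℝ) [IsProbabilityMeasure μ], Continuous fun s : ℝ =>
      ∫ t in (0:ℝ)..1, (1 - t) * (Complex.exp (-(t * s) * Complex.I) * charFun μ t).re := by
    intro μ _
    have : Continuous (charFun μ) := continuous_charFun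
    exact intervalIntegral.continuous_parametric_intervalIntegral_of_continuous' (by fun_prop) 0 1
  simp_rw [integral_fejerKernel_sub]
  rw [← intervalIntegral.integral_sub ((hc ν).intervalIntegrable _ _)
    ((hc γ).intervalIntegrable _ _)]
  have e1 : ∀ s : ℝ,
      (∫ t in (0:ℝ)..1, (1 - t) * (Complex.exp (-(t * s) * Complex.I) * charFun ν t).re) -
      (∫ t in (0:ℝ)..1, (1 - t) * (Complex.exp (-(t * s) * Complex.I) * charFun γ t).re) =
      ∫ t in (0:ℝ)..1, (1 - t) *
        (Complex.exp (-(t * s) * Complex.I) * (charFun ν t - charFun γ t)).re := by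
    intro s
    rw [← intervalIntegral.integral_sub (Continuous.intervalIntegrable (by fun_prop) _ _)
      (Continuous.intervalIntegrable (by fun_prop) _ _)]
    refine intervalIntegral.integral_congr fun t _ => ?_
    simp only [mul_sub, Complex.sub_re]
  simp_rw [e1]
  rw [intervalIntegral_intervalIntegral_swap, ← Real.norm_eq_abs,
    ← intervalIntegral.integral_const_mul]
  · refine intervalIntegral.norm_integral_le_of_norm_le zero_le_one (ae_of_all _ fun t ht => ?_)
      (hβ.const_mul 2)
    have ht0 : (t : ℂ) ≠ 0 := by exact_mod_cast ht.1.ne'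
    have hne : -((t : ℂ)) * Complex.I ≠ 0 := mul_ne_zero (neg_ne_zero.2 ht0) Complex.I_ne_zero
    have e2 : ∫ s in b..a, (1 - t) *
        (Complex.exp (-(t * s) * Complex.I) * (charFun ν t - charFun γ t)).re =
        (1 - t) * ((∫ s in b..a, Complex.exp (-(t : ℂ) * Complex.I * s)) *
          (charFun ν t - charFun γ t)).re := by
      rw [intervalIntegral.integral_const_mul, ← intervalIntegral.integral_mul_const]
      congr 1
      have := Complex.reCLM.intervalIntegral_comp_comm (a := b) (b := a) (μ := volume)
        (f := fun s : ℝ => Complex.exp (-(t : ℂ) * Complex.I * s) *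
          (charFun ν t - charFun γ t)) (Continuous.intervalIntegrable (by fun_prop) _ _)
      simp only [Complex.reCLM_apply] at this
      rw [← this]
      refine intervalIntegral.integral_congr fun s _ => ?_
      congr 3
      ring
    rw [e2, integral_exp_mul_complex hne, norm_mul, Real.norm_of_nonneg (by linarith [ht.2])]
    have hn : ∀ s : ℝ, ‖Complex.exp (-(t : ℂ) * Complex.I * s)‖ = 1 := by
      intro s
      rw [show -(t : ℂ) * Complex.I * s = ((-t * s : ℝ) : ℂ) * Complex.I by push_cast; ring,
        Complex.norm_exp_ofReal_mul_I]
    have hd : ‖(Complex.exp (-(t : ℂ) * Complex.I * a) -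
        Complex.exp (-(t : ℂ) * Complex.I * b)) / (-(t : ℂ) * Complex.I)‖ ≤ 2 / t := by
      rw [norm_div, norm_mul, norm_neg, Complex.norm_I, mul_one, Complex.norm_real,
        Real.norm_of_nonneg ht.1.le]
      have hle := norm_sub_le (Complex.exp (-(t : ℂ) * Complex.I * a))
        (Complex.exp (-(t : ℂ) * Complex.I * b))
      rw [hn, hn] at hle
      have := ht.1
      gcongr
      linarith
    calc (1 - t) * ‖(((Complex.exp (-(t : ℂ) * Complex.I * a) -
          Complex.exp (-(t : ℂ) * Complex.I * b)) / (-(t : ℂ) * Complex.I)) *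
            (charFun ν t - charFun γ t)).re‖
        ≤ 1 * ((2 / t) * (t * β t)) := by
          refine mul_le_mul (by linarith [ht.1]) ?_ (norm_nonneg _) zero_le_one
          refine (Complex.abs_re_le_norm _).trans ?_
          rw [norm_mul]
          exact mul_le_mul hd (h t ht) (norm_nonneg _) (by have := ht.1; positivity)
      _ = 2 * β t := by have := ht.1.ne'; field_simp
  · refine IntegrableOn.mono_set (t := Set.uIcc b a ×ˢ Set.uIcc 0 1) ?_
      (Set.prod_mono Set.uIoc_subset_uIcc Set.uIoc_subset_uIcc)
    exact hcont.continuousOn.integrableOn_compact (isCompact_uIcc.prod isCompact_uIcc)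

lemma measureReal_Ioc_eq (ν : Measure ℝ) [IsProbabilityMeasure ν] {x y : ℝ} (hxy : x ≤ y) :
    ν.real (Set.Ioc x y) = cdf ν y - cdf ν x := by
  rw [cdf_eq_real, cdf_eq_real, ← Set.Iic_sdiff_Iic, measureReal_sdiff
    (Set.Iic_subset_Iic.2 hxy) measurableSet_Iic]

/-- Let b → -∞ in the bound for interval masses: both distribution functions vanish there, and
dominated convergence applies. -/
lemma abs_integral_fejerKernel_mul_cdf_sub_le (ν γ : Measure ℝ) [IsProbabilityMeasure ν]
    [IsProbabilityMeasure γ] {β : ℝ → ℝ} (hβ : IntervalIntegrable β volume 0 1)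
    (h : ∀ t ∈ Set.Ioc (0:ℝ) 1, ‖charFun ν t - charFun γ t‖ ≤ t * β t) (a : ℝ) :
    |∫ v, fejerKernel v * (cdf ν (v + a) - cdf γ (v + a))| ≤ 2 * ∫ t in (0:ℝ)..1, β t := by
  have hm : ∀ (μ : Measure ℝ) (c : ℝ), Measurable fun v => cdf μ (v + c) := fun μ c =>
    ((monotone_cdf μ).measurable).comp (measurable_id.add_const c)
  have hmk := continuous_fejerKernel.measurable
  have habs : ∀ x : ℝ, |cdf ν x - cdf γ x| ≤ 1 := fun x => by
    have h1 := cdf_nonneg ν x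
    have h2 := cdf_nonneg γ x
    have h3 := cdf_le_one ν x
    have h4 := cdf_le_one γ x
    rw [abs_le]; constructor <;> linarith
  have hlim : Filter.Tendsto (fun b : ℝ => ∫ v, fejerKernel v *
      ((cdf ν (v + a) - cdf γ (v + a)) - (cdf ν (v + b) - cdf γ (v + b)))) Filter.atBot
      (nhds (∫ v, fejerKernel v * ((cdf ν (v + a) - cdf γ (v + a)) - (0 - 0)))) := by
    refine tendsto_integral_filter_of_dominated_convergence (fun v => 2 * fejerKernel v)
      (Filter.Eventually.of_forall fun b => ?_) (Filter.Eventually.of_forall fun b => ?_)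
      (integrable_fejerKernel.const_mul 2) (ae_of_all _ fun v => ?_)
    · exact (hmk.mul (((hm ν a).sub (hm γ a)).sub ((hm ν b).sub (hm γ b)))).aestronglyMeasurable
    · refine ae_of_all _ fun v => ?_
      rw [norm_mul, Real.norm_of_nonneg (fejerKernel_nonneg v), mul_comm, Real.norm_eq_abs]
      refine mul_le_mul_of_nonneg_right ((abs_sub _ _).trans ?_) (fejerKernel_nonneg v)
      linarith [habs (v + a), habs (v + b)]
    · have hb : Filter.Tendsto (fun b : ℝ => v + b) Filter.atBot Filter.atBot :=
        Filter.tendsto_atBot_add_const_left _ _ Filter.tendsto_id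
      exact tendsto_const_nhds.mul (tendsto_const_nhds.sub
        (((tendsto_cdf_atBot ν).comp hb).sub ((tendsto_cdf_atBot γ).comp hb)))
  simp only [sub_zero] at hlim
  refine le_of_tendsto hlim.abs ?_
  filter_upwards [Filter.eventually_le_atBot a] with b hb
  have key := abs_intervalIntegral_sub_le ν γ hβ h b a
  rw [intervalIntegral_integral_fejerKernel ν hb, intervalIntegral_integral_fejerKernel γ hb] at key
  simp_rw [fun (μ : Measure ℝ) [IsProbabilityMeasure μ] (v : ℝ) => measureReal_Ioc_eq μ
    (show v + b ≤ v + a by linarith)] at key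
  have hint : ∀ (μ : Measure ℝ), Integrable fun v => fejerKernel v *
      (cdf μ (v + a) - cdf μ (v + b)) := fun μ => by
    refine integrable_fejerKernel.mono' (hmk.mul ((hm μ a).sub (hm μ b))).aestronglyMeasurable
      (ae_of_all _ fun v => ?_)
    rw [norm_mul, Real.norm_of_nonneg (fejerKernel_nonneg v)]
    refine mul_le_of_le_one_right (fejerKernel_nonneg v) ?_
    rw [Real.norm_eq_abs, abs_le]
    have h1 := cdf_nonneg μ (v + a)
    have h2 := cdf_nonneg μ (v + b)
    have h3 := cdf_le_one μ (v + a)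
    have h4 := cdf_le_one μ (v + b)
    constructor <;> linarith
  rw [← integral_sub (hint ν) (hint γ)] at key
  refine (congrArg abs (integral_congr_ae (ae_of_all _ fun v => ?_))).trans_le key
  ring

/-- **Esseen's smoothing inequality**, with the cutoff of the characteristic functions at `1`. -/
lemma abs_cdf_sub_cdf_le (ν γ : Measure ℝ) [IsProbabilityMeasure ν]
    [IsProbabilityMeasure γ] {β : ℝ → ℝ} (hβ : IntervalIntegrable β volume 0 1)
    (h : ∀ t ∈ Set.Ioc (0:ℝ) 1, ‖charFun ν t - charFun γ t‖ ≤ t * β t) {m : ℝ}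
    (hγ : ∀ x y, x ≤ y → cdf γ y - cdf γ x ≤ m * (y - x)) (x : ℝ) :
    |cdf ν x - cdf γ x| ≤ 96 * m + 6 * ∫ t in (0:ℝ)..1, β t := by
  have hm0 : 0 ≤ m := by
    have := hγ 0 1 zero_le_one
    have := monotone_cdf γ (zero_le_one' ℝ)
    linarith
  set J := ∫ t in (0:ℝ)..1, β t
  set Δ : ℝ → ℝ := fun x => cdf ν x - cdf γ x with hΔ
  have habs : ∀ x : ℝ, |Δ x| ≤ 1 := fun x => by
    have h1 := cdf_nonneg ν x
    have h2 := cdf_nonneg γ x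
    have h3 := cdf_le_one ν x
    have h4 := cdf_le_one γ x
    rw [abs_le]; constructor <;> simp only [hΔ] <;> linarith
  have hbdd : BddAbove (Set.range fun x => |Δ x|) := ⟨1, by rintro _ ⟨x, rfl⟩; exact habs x⟩
  set η := ⨆ x, |Δ x| with hη
  have hle : ∀ x, |Δ x| ≤ η := fun x => le_ciSup hbdd x
  have hmeas : Measurable Δ := (monotone_cdf ν).measurable.sub (monotone_cdf γ).measurable
  -- The half-width 32 makes the tail mass at most 4/32 = 1/8, a quarter of the lower bound 1/2 for
  -- the central mass, so that the tail contribution can be absorbed into η.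
  set c := ∫ v in Set.Icc (-32:ℝ) 32, fejerKernel v with hc
  set τ := ∫ v in (Set.Icc (-32:ℝ) 32)ᶜ, fejerKernel v with hτ
  have hc2 : 1 / 2 ≤ c := half_le_setIntegral_fejerKernel (by norm_num)
  have hτ2 : τ ≤ 1 / 8 := by
    have := setIntegral_fejerKernel_compl_le (h := 32) (by norm_num)
    linarith
  have hη0 : 0 ≤ η := (abs_nonneg _).trans (hle 0)
  -- A value D x persists, up to 64 m, on a window of length 64, because ν is monotone and γ is
  -- Lipschitz. There the smoothed integral is at least (D x - 64 m)/2, and the tails cost at most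
  -- η/8. The window lies to the right of x for Δ and to the left for -Δ.
  have main : ∀ (D : ℝ → ℝ), Measurable D → (∀ x, |D x| ≤ η) →
      (∀ a, ∫ v, fejerKernel v * D (v + a) ≤ 2 * J) →
      ∀ x a, (∀ v ∈ Set.Icc (-32:ℝ) 32, D x - 64 * m ≤ D (v + a)) →
      D x ≤ 64 * m + 4 * J + η / 4 := by
    intro D hDm hDη hDJ x a hxa
    have hint : Integrable fun v => fejerKernel v * D (v + a) := by
      refine (integrable_fejerKernel.const_mul η).mono' (continuous_fejerKernel.measurable.mul
        (hDm.comp (measurable_id.add_const a))).aestronglyMeasurable (ae_of_all _ fun v => ?_)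
      rw [norm_mul, Real.norm_of_nonneg (fejerKernel_nonneg v), mul_comm]
      exact mul_le_mul_of_nonneg_right (hDη _) (fejerKernel_nonneg v)
    have h1 := hDJ a
    rw [← integral_add_compl (measurableSet_Icc (a := (-32:ℝ)) (b := 32)) hint] at h1
    have h2 : c * (D x - 64 * m) ≤ ∫ v in Set.Icc (-32:ℝ) 32, fejerKernel v * D (v + a) := by
      rw [hc, ← integral_mul_const]
      refine setIntegral_mono_on (integrable_fejerKernel.integrableOn.mul_const _)
        hint.integrableOn measurableSet_Icc fun v hv => ?_
      exact mul_le_mul_of_nonneg_left (hxa v hv) (fejerKernel_nonneg v)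
    have h3 : τ * (-η) ≤ ∫ v in (Set.Icc (-32:ℝ) 32)ᶜ, fejerKernel v * D (v + a) := by
      rw [hτ, ← integral_mul_const]
      refine setIntegral_mono_on (integrable_fejerKernel.integrableOn.mul_const _)
        hint.integrableOn measurableSet_Icc.compl fun v hv => ?_
      exact mul_le_mul_of_nonneg_left (neg_le_of_abs_le (hDη _)) (fejerKernel_nonneg v)
    by_contra! hcon
    have hJ0 : 0 ≤ 2 * J := (abs_nonneg _).trans
      (abs_integral_fejerKernel_mul_cdf_sub_le ν γ hβ h 0)
    have h4 : 1 / 2 * (D x - 64 * m) ≤ c * (D x - 64 * m) :=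
      mul_le_mul_of_nonneg_right hc2 (by linarith)
    have h5 : τ * η ≤ 1 / 8 * η := mul_le_mul_of_nonneg_right hτ2 hη0
    linarith
  have hJ := abs_integral_fejerKernel_mul_cdf_sub_le ν γ hβ h
  have hbound : ∀ x, |Δ x| ≤ 64 * m + 4 * J + η / 4 := by
    intro x
    refine abs_le'.2 ⟨?_, ?_⟩
    · refine main Δ hmeas hle (fun a => (le_abs_self _).trans (hJ a)) x (x + 32) fun v hv => ?_
      have h1 := monotone_cdf ν (show x ≤ v + (x + 32) by linarith [hv.1])
      have h2 := hγ x (v + (x + 32)) (by linarith [hv.1])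
      have h3 : m * (v + (x + 32) - x) ≤ m * 64 :=
        mul_le_mul_of_nonneg_left (by linarith [hv.2]) hm0
      simp only [hΔ]
      linarith
    · refine main (fun x => - Δ x) hmeas.neg (fun x => by rw [abs_neg]; exact hle x)
        (fun a => ?_) x (x - 32) fun v hv => ?_
      · simp only [mul_neg, integral_neg]
        exact (neg_le_abs _).trans (hJ a)
      · have h1 := monotone_cdf ν (show v + (x - 32) ≤ x by linarith [hv.2])
        have h2 := hγ (v + (x - 32)) x (by linarith [hv.2])
        have h3 : m * (x - (v + (x - 32))) ≤ m * 64 :=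
          mul_le_mul_of_nonneg_left (by linarith [hv.1]) hm0
        simp only [hΔ]
        linarith
  -- So 3η/4 ≤ 64m + 4J; multiplying by 3/2 gives the stated constants, as 9η/8 ≥ η.
  have hfin : η ≤ 64 * m + 4 * J + η / 4 := ciSup_le hbound
  have := hle x
  linarith

/-! ### Minimum principle and almost typically real functions -/

section MinimumPrinciple

open Complex Metric Set

/-- Minimum principle for the real part of a holomorphic function. -/
lemma le_re_of_forall_mem_frontier_le_re {f : ℂ → ℂ} {U : Set ℂ} (hU : Bornology.IsBounded U)
    (hd : DiffContOnCl ℂ f U) {c : ℝ} (hc : ∀ z ∈ frontier U, c ≤ (f z).re) {z : ℂ}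
    (hz : z ∈ closure U) : c ≤ (f z).re := by
  have h := norm_le_of_forall_mem_frontier_norm_le (f := fun z => exp (-f z)) (C := Real.exp (-c))
    hU ⟨hd.1.neg.cexp, hd.2.neg.cexp⟩ (fun w hw => by
      rw [norm_exp, neg_re]; exact Real.exp_le_exp.2 (neg_le_neg (hc w hw))) hz
  rw [norm_exp, neg_re, Real.exp_le_exp] at h
  linarith

/-- Coefficient bound for an (approximately) typically real function: a function with real
symmetry whose imaginary part is almost nonnegative on the upper half of a circle is close to its
linear part. -/
lemma norm_sub_sub_le_of_im_nonneg {g : ℂ → ℂ} {r s ε d : ℝ} (hr : 0 < r) (hrs : r < s)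
    (hg : DifferentiableOn ℂ g (ball 0 s))
    (hsymm : ∀ z ∈ ball (0:ℂ) s, g ((starRingEnd ℂ) z) = (starRingEnd ℂ) (g z))
    (him : ∀ z : ℂ, ‖z‖ = r → 0 ≤ z.im → -ε ≤ (g z).im)
    (hε : 0 ≤ ε) (hd : 0 < d) (hdg : deriv g 0 = d) {w : ℂ} (hw : ‖w‖ ≤ r / 2) :
    ‖g w - g 0 - d * w‖ ≤ 6 * (d + 2 * ε / r) * ‖w‖ ^ 2 / r := by
  have h0s : (0:ℂ) ∈ ball (0:ℂ) s := mem_ball_self (hr.trans hrs)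
  have hr0 : (r : ℂ) ≠ 0 := by exact_mod_cast hr.ne'
  have hg0 : (g 0).im = 0 := by
    have := hsymm 0 h0s
    rw [map_zero] at this
    exact (conj_eq_iff_im.1 this.symm)
  -- On |z| = r the factor (1 - z²/r²)/z equals (conj z - z)/r², which is purely imaginary. So Re h
  -- = 2 Im z · Im g / r² there, almost nonnegative by symmetry, while h(0) = d.
  set h : ℂ → ℂ := fun z => dslope g 0 z * (1 - (z / r) ^ 2) with hh
  have hds : DifferentiableOn ℂ (dslope g 0) (ball 0 s) :=
    (differentiableOn_dslope (isOpen_ball.mem_nhds h0s)).2 hg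
  have hhd : DifferentiableOn ℂ h (ball 0 s) := hds.mul (by fun_prop)
  have hh0 : h 0 = d := by simp [hh, dslope_same, hdg]
  have hbd : ∀ z ∈ frontier (ball (0:ℂ) r), -(2 * ε / r) ≤ (h z).re := by
    intro z hz
    rw [frontier_ball _ hr.ne', mem_sphere_zero_iff_norm] at hz
    have hzs : z ∈ ball (0:ℂ) s := by simpa [hz] using hrs
    have hz0 : z ≠ 0 := by rw [← norm_pos_iff, hz]; exact hr
    have hzz : z * (starRingEnd ℂ) z = (r : ℂ) ^ 2 := by
      rw [mul_conj, normSq_eq_norm_sq, hz]; push_cast; rfl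
    have e : h z = (g z - g 0) * ((starRingEnd ℂ) z - z) / r ^ 2 := by
      simp only [hh]
      rw [dslope_of_ne _ hz0, slope_def_field, sub_zero]
      field_simp
      rw [← hzz]
      ring
    have e2 : (h z).re = 2 * z.im * (g z).im / r ^ 2 := by
      rw [e, ← ofReal_pow, div_ofReal_re]
      congr 1
      simp [mul_re, hg0]
      ring
    rw [e2]
    have hzim : |z.im| ≤ r := hz ▸ abs_im_le_norm z
    have key : -(r * ε) ≤ z.im * (g z).im := by
      rcases le_total 0 z.im with hi | hi
      · have := him z hz hi
        have h1 : z.im ≤ r := (le_abs_self _).trans hzim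
        nlinarith
      · have := him ((starRingEnd ℂ) z) (by rwa [norm_conj]) (by simpa using hi)
        rw [hsymm z hzs, conj_im] at this
        have h1 : -z.im ≤ r := (neg_le_abs _).trans hzim
        nlinarith
    rw [le_div_iff₀ (by positivity)]
    have : -(2 * ε / r) * r ^ 2 = 2 * -(r * ε) := by field_simp
    rw [this]; linarith
  have hcl : closure (ball (0:ℂ) r) ⊆ ball 0 s := by
    rw [closure_ball _ hr.ne']; exact closedBall_subset_ball hrs
  have hre : ∀ z ∈ ball (0:ℂ) r, -(2 * ε / r) ≤ (h z).re := fun z hz =>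
    le_re_of_forall_mem_frontier_le_re isBounded_ball (hhd.mono hcl).diffContOnCl hbd
      (subset_closure hz)
  set M := d + 2 * ε / r with hM
  have hM0 : 0 < M := by positivity
  have hdM : d ≤ M := by have : 0 ≤ 2 * ε / r := by positivity
                         linarith
  have hwr : ‖w‖ < r := by linarith
  -- Borel–Carathéodory: d - h vanishes at 0 and has real part at most M on the disk.
  have hBC : ‖(d : ℂ) - h w‖ ≤ 2 * M * ‖w‖ / (r - ‖w‖) := by
    refine borelCaratheodory_zero (f := fun z => (d : ℂ) - h z) hM0
      ((hhd.mono (ball_subset_ball hrs.le)).const_sub _) (fun z hz => ?_) hr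
      (by simpa using hwr) (by simp [hh0])
    simp only [mem_ofPred_eq, sub_re, ofReal_re]
    linarith [hre z hz]
  have hBC2 : ‖(d : ℂ) - h w‖ ≤ 4 * M * ‖w‖ / r := by
    refine hBC.trans ?_
    rw [div_le_div_iff₀ (by linarith) hr]
    have : 0 ≤ M * ‖w‖ := by positivity
    nlinarith
  have hq : ‖(w / r) ^ 2‖ ≤ ‖w‖ / (2 * r) := by
    rw [norm_pow, norm_div, norm_real, Real.norm_of_nonneg hr.le, div_pow,
      div_le_div_iff₀ (by positivity) (by positivity)]
    nlinarith [norm_nonneg w, mul_nonneg (norm_nonneg w) hr.le]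
  have hq2 : ‖(w / r) ^ 2‖ ≤ 1 / 4 := by
    refine hq.trans ?_
    rw [div_le_div_iff₀ (by positivity) (by positivity)]
    linarith
  have hden : 3 / 4 ≤ ‖1 - (w / r) ^ 2‖ := by
    have := norm_sub_norm_le (1:ℂ) ((w / r) ^ 2)
    rw [norm_one] at this
    linarith
  have hgw : (g w - g 0 - d * w) * (1 - (w / r) ^ 2) = w * ((h w - d) + d * (w / r) ^ 2) := by
    have : g w - g 0 = w * dslope g 0 w := by
      have := sub_smul_dslope g 0 w
      simp only [sub_zero, smul_eq_mul] at this
      exact this.symm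
    rw [this]
    simp only [hh]
    ring
  have hn : ‖g w - g 0 - d * w‖ * (3 / 4) ≤ ‖w‖ * (4 * M * ‖w‖ / r + M * (‖w‖ / (2 * r))) := by
    calc ‖g w - g 0 - d * w‖ * (3 / 4)
        ≤ ‖g w - g 0 - d * w‖ * ‖1 - (w / r) ^ 2‖ :=
          mul_le_mul_of_nonneg_left hden (norm_nonneg _)
      _ = ‖w‖ * ‖(h w - d) + d * (w / r) ^ 2‖ := by rw [← norm_mul, hgw, norm_mul]
      _ ≤ _ := by
        refine mul_le_mul_of_nonneg_left ((norm_add_le _ _).trans (add_le_add ?_ ?_))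
          (norm_nonneg _)
        · rwa [norm_sub_rev]
        · rw [norm_mul, norm_real, Real.norm_of_nonneg hd.le]
          exact mul_le_mul hdM hq (norm_nonneg _) hM0.le
  have : ‖w‖ * (4 * M * ‖w‖ / r + M * (‖w‖ / (2 * r))) = 3 / 4 * (6 * M * ‖w‖ ^ 2 / r) := by
    field_simp; ring
  linarith

/-- A nonnegative function that vanishes at the right end point has nonpositive derivative there. -/
lemma deriv_nonpos_of_nonneg_of_eq_zero {q : ℝ → ℝ} {q' b : ℝ} (hb : 0 < b)
    (hq : HasDerivAt q q' b) (h0 : q b = 0) (hnn : ∀ y ∈ Ioo 0 b, 0 ≤ q y) : q' ≤ 0 := by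
  have hs := (hasDerivAt_iff_tendsto_slope_left_right.1 hq).1
  refine le_of_tendsto hs ?_
  filter_upwards [Ioo_mem_nhdsLT hb] with y hy
  rw [slope_def_field, h0, sub_zero]
  exact div_nonpos_of_nonneg_of_nonpos (hnn y hy) (by linarith [hy.2])

lemma reProdIm_frontier_cases {a b : ℝ} (ha : 0 < a) (hb : 0 < b) {z : ℂ}
    (hz : z ∈ frontier (Ioo (-a) a ×ℂ Ioo 0 b)) :
    |z.re| ≤ a ∧ z.im ∈ Icc 0 b ∧ (|z.re| = a ∨ z.im = 0 ∨ z.im = b) := by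
  rw [frontier_reProdIm, frontier_Ioo (a := -a) (b := a) (by linarith), frontier_Ioo hb,
    closure_Ioo (a := -a) (b := a) (by linarith),
    closure_Ioo hb.ne] at hz
  rcases hz with ⟨h1, h2⟩ | ⟨h1, h2⟩
  · refine ⟨abs_le.2 h1, ?_, Or.inr ?_⟩
    · rcases h2 with h2 | h2
      · rw [h2]; simp [hb.le]
      · rw [h2]; simp [hb.le]
    · simpa using h2
  · have : |z.re| = a := by
      rcases h1 with h1 | h1 <;> rw [h1]
      · rw [abs_neg, abs_of_pos ha]
      · exact abs_of_pos ha
    exact ⟨this.le, h2, Or.inl this⟩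

end MinimumPrinciple

/-! ### Reflection in horizontal lines -/

section Reflection

open Complex Metric Set

lemma re_cosh (z : ℂ) : (cosh z).re = Real.cosh z.re * Real.cos z.im := by
  rw [Complex.cosh, show (2:ℂ) = ((2:ℝ):ℂ) by norm_num, div_ofReal_re, add_re, exp_re, exp_re,
    Real.cosh_eq]
  simp
  ring

lemma im_sinh (z : ℂ) : (sinh z).im = Real.cosh z.re * Real.sin z.im := by
  rw [Complex.sinh, show (2:ℂ) = ((2:ℝ):ℂ) by norm_num, div_ofReal_im, sub_im, exp_im, exp_im,
    Real.cosh_eq]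
  simp
  ring

/-- This makes the cosh barrier, normalized on the vertical sides, exponentially small in the middle
half of the rectangle. -/
lemma cosh_div_cosh_le {x a : ℝ} (ha : 0 ≤ a) (hx : |x| ≤ a / 2) :
    Real.cosh x / Real.cosh a ≤ 2 * Real.exp (-(a / 2)) := by
  rw [div_le_iff₀ (Real.cosh_pos a)]
  have h1 : Real.cosh x ≤ Real.exp (a / 2) := by
    rw [← Real.cosh_abs]
    refine (Real.cosh_le_cosh.2 ?_).trans (b := Real.cosh (a / 2)) ?_
    · rw [abs_abs, abs_of_nonneg (by linarith : 0 ≤ a / 2)]; exact hx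
    · rw [Real.cosh_eq]
      have : Real.exp (-(a / 2)) ≤ Real.exp (a / 2) := Real.exp_le_exp.2 (by linarith)
      linarith
  have h2 : Real.exp a / 2 ≤ Real.cosh a := by
    rw [Real.cosh_eq]
    have := Real.exp_pos (-a)
    linarith
  have h3 : Real.exp (a / 2) = 2 * Real.exp (-(a / 2)) * (Real.exp a / 2) := by
    have : Real.exp a = Real.exp (a / 2) * Real.exp (a / 2) := by rw [← Real.exp_add]; ring_nf
    rw [this, Real.exp_neg]
    have := Real.exp_pos (a / 2)
    field_simp
  have := mul_le_mul_of_nonneg_left h2 (show 0 ≤ 2 * Real.exp (-(a / 2)) by positivity)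
  linarith

lemma mem_ball_of_abs_re_le_of_abs_im_le {z : ℂ} {a b ρ : ℝ} (h1 : |z.re| ≤ a) (h2 : |z.im| ≤ b)
    (h : a + b < ρ) : z ∈ ball (0:ℂ) ρ := by
  rw [mem_ball_zero_iff]
  exact (norm_le_abs_re_add_abs_im z).trans_lt (by linarith)

/-- If the real part of a function `φ` with real symmetry is maximal, on each vertical line, at
the real axis, then by reflection in the lines `Im z = b` it is almost decreasing away from the
real axis. -/
lemma neg_le_im_deriv_of_re_le {φ g : ℂ → ℂ} {ρ a b L x : ℝ} (ha : 0 < a) (hb : 0 < b)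
    (hab : a + 2 * b < ρ) (hφ : ∀ z ∈ ball (0:ℂ) ρ, HasDerivAt φ (g z) z)
    (hL : ∀ z ∈ ball (0:ℂ) ρ, ‖g z‖ ≤ L)
    (hre : ∀ z ∈ ball (0:ℂ) ρ, (φ z).re ≤ (φ z.re).re)
    (hφs : ∀ z ∈ ball (0:ℂ) ρ, (φ ((starRingEnd ℂ) z)).re = (φ z).re)
    (hgs : ∀ z ∈ ball (0:ℂ) ρ, g ((starRingEnd ℂ) z) = (starRingEnd ℂ) (g z))
    (hx : |x| ≤ a / 2) :
    -(Real.pi * L * Real.exp (-(Real.pi * a / (4 * b)))) ≤ (g (x + b * I)).im := by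
  have hL0 : 0 ≤ L := (norm_nonneg _).trans (hL 0 (mem_ball_self (by linarith)))
  have hpi := Real.pi_pos
  set κ : ℝ := Real.pi / (2 * b) with hκ
  have hκ0 : 0 < κ := by positivity
  have hκb : κ * b = Real.pi / 2 := by rw [hκ]; field_simp
  set K : ℝ := 2 * L * b / Real.cosh (κ * a) with hK
  have hc0 := Real.cosh_pos (κ * a)
  have hK0 : 0 ≤ K := by positivity
  -- By symmetry Re φ(z - 2bi) is Re φ at the reflection of z in Im z = b, but this form is
  -- holomorphic. The barrier K cosh(κz) has real part vanishing on Im z = b, since κb = π/2; K is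
  -- chosen to offset the Lipschitz loss on the vertical sides.
  set f : ℂ → ℂ := fun z => φ z - φ (z - 2 * b * I) + K * cosh (κ * z) with hf
  have hin : ∀ z : ℂ, |z.re| ≤ a → z.im ∈ Icc 0 b → z ∈ ball (0:ℂ) ρ ∧
      z - 2 * b * I ∈ ball (0:ℂ) ρ := by
    intro z h1 h2
    refine ⟨mem_ball_of_abs_re_le_of_abs_im_le h1 (b := 2 * b) ?_ hab,
      mem_ball_of_abs_re_le_of_abs_im_le (a := a) (b := 2 * b) ?_ ?_ hab⟩
    · rw [abs_le]; constructor <;> linarith [h2.1, h2.2]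
    · simpa using h1
    · simp only [sub_im, mul_im, mul_re, re_ofNat, im_ofNat, ofReal_re, ofReal_im, I_re, I_im]
      rw [abs_le]; constructor <;> linarith [h2.1, h2.2]
  have hfd : ∀ z : ℂ, |z.re| ≤ a → z.im ∈ Icc 0 b →
      HasDerivAt f (g z - g (z - 2 * b * I) + K * (sinh (κ * z) * κ)) z := by
    intro z h1 h2
    obtain ⟨h3, h4⟩ := hin z h1 h2
    have h5 : HasDerivAt (fun z => φ (z - 2 * b * I)) (g (z - 2 * b * I)) z :=
      (hφ _ h4).comp_sub_const z (2 * b * I)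
    have h6 : HasDerivAt (fun z : ℂ => (κ : ℂ) * z) κ z := by
      simpa using (hasDerivAt_id z).const_mul (κ : ℂ)
    exact ((hφ z h3).sub h5).add (h6.ccosh.const_mul _)
  have hfre : ∀ z, (f z).re = (φ z).re - (φ (z - 2 * b * I)).re +
      K * (Real.cosh (κ * z.re) * Real.cos (κ * z.im)) := by
    intro z
    simp only [hf, add_re, sub_re, re_ofReal_mul, re_cosh, im_ofReal_mul]
  have hconj : ∀ z : ℂ, z.im = b → z - 2 * b * I = (starRingEnd ℂ) z := by
    intro z hz
    apply Complex.ext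
    · simp
    · simp [hz]; ring
  have hcosnn : ∀ y ∈ Icc 0 b, 0 ≤ Real.cos (κ * y) := by
    intro y hy
    refine Real.cos_nonneg_of_neg_pi_div_two_le_of_le ?_ ?_
    · have : 0 ≤ κ * y := mul_nonneg hκ0.le hy.1
      linarith
    · rw [← hκb]; exact mul_le_mul_of_nonneg_left hy.2 hκ0.le
  have hfr : ∀ z ∈ frontier (Ioo (-a) a ×ℂ Ioo 0 b), 0 ≤ (f z).re := by
    intro z hz
    obtain ⟨h1, h2, h3⟩ := reProdIm_frontier_cases ha hb hz
    obtain ⟨h4, h5⟩ := hin z h1 h2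
    rw [hfre]
    have hcn := hcosnn _ h2
    have hch := Real.cosh_pos (κ * z.re)
    have hlast : 0 ≤ K * (Real.cosh (κ * z.re) * Real.cos (κ * z.im)) := by positivity
    rcases h3 with h3 | h3 | h3
    -- Vertical sides: the two values of Re φ differ by at most 2L(b - Im z), and Jordan's
    -- inequality cos(κy) ≥ 1 - y/b lets the barrier cover it.
    · have e1 : Real.cosh (κ * z.re) = Real.cosh (κ * a) := by
        rw [← Real.cosh_abs, abs_mul, abs_of_pos hκ0, h3]
      have e2 : K * (Real.cosh (κ * z.re) * Real.cos (κ * z.im)) =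
          2 * L * b * Real.cos (κ * z.im) := by
        rw [e1, hK]; field_simp
      have e3 : 1 - z.im / b ≤ Real.cos (κ * z.im) := by
        have := Real.one_sub_mul_le_cos (x := κ * z.im) (mul_nonneg hκ0.le h2.1)
          (by rw [← hκb]; exact mul_le_mul_of_nonneg_left h2.2 hκ0.le)
        have e : 2 / Real.pi * (κ * z.im) = z.im / b := by rw [hκ]; field_simp
        rwa [e] at this
      have h6 : (starRingEnd ℂ) (z - 2 * b * I) ∈ ball (0:ℂ) ρ := by
        rwa [mem_ball_zero_iff, norm_conj, ← mem_ball_zero_iff]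
      have h7 := (convex_ball (0:ℂ) ρ).norm_image_sub_le_of_norm_hasDerivWithin_le
        (fun w hw => (hφ w hw).hasDerivWithinAt) hL h4 h6
      have h8 : ‖(starRingEnd ℂ) (z - 2 * b * I) - z‖ = 2 * (b - z.im) := by
        have : (starRingEnd ℂ) (z - 2 * b * I) - z = ((2 * (b - z.im) : ℝ) : ℂ) * I := by
          apply Complex.ext
          · simp
          · simp; ring
        rw [this, norm_mul, norm_I, mul_one, norm_real, Real.norm_of_nonneg]
        linarith [h2.2]
      have h9 := (abs_re_le_norm _).trans h7
      rw [sub_re, hφs _ h5, h8, abs_le] at h9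
      rw [e2]
      have h10 : 2 * L * b * (1 - z.im / b) ≤ 2 * L * b * Real.cos (κ * z.im) :=
        mul_le_mul_of_nonneg_left e3 (by positivity)
      have h11 : 2 * L * b * (1 - z.im / b) = L * (2 * (b - z.im)) := by field_simp
      linarith [h9.2]
    -- Real side: Re φ is maximal at the real axis.
    · have h6 := hre _ h5
      have h7 : ((z - 2 * b * I).re : ℂ) = z := by
        apply Complex.ext
        · simp
        · simp [h3]
      rw [h7] at h6
      linarith
    · rw [hconj z h3, hφs z h4]
      linarith
  have hcl : closure (Ioo (-a) a ×ℂ Ioo 0 b) = Icc (-a) a ×ℂ Icc 0 b := by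
    rw [closure_reProdIm, closure_Ioo (by linarith : -a ≠ a), closure_Ioo hb.ne]
  have hmin : ∀ z : ℂ, |z.re| ≤ a → z.im ∈ Icc 0 b → 0 ≤ (f z).re := by
    intro z h1 h2
    refine le_re_of_forall_mem_frontier_le_re
      ((isBounded_Ioo _ _).reProdIm (isBounded_Ioo _ _)) ?_ hfr ?_
    · refine DifferentiableOn.diffContOnCl ?_
      rw [hcl]
      exact fun w hw => (hfd w (abs_le.2 hw.1) hw.2).differentiableAt.differentiableWithinAt
    · rw [hcl]
      exact ⟨abs_le.1 h1, h2⟩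
  have hxa : |x| ≤ a := by linarith
  set z₀ : ℂ := x + b * I with hz₀
  have hz₀re : z₀.re = x := by simp [hz₀]
  have hz₀im : z₀.im = b := by simp [hz₀]
  have hz₀b := hin z₀ (by rwa [hz₀re]) (by rw [hz₀im]; exact ⟨hb.le, le_rfl⟩)
  have hq : HasDerivAt (fun y : ℝ => (f (x + y * I)).re)
      ((g z₀ - g (z₀ - 2 * b * I) + K * (sinh (κ * z₀) * κ)) * I).re b := by
    have h1 := hfd z₀ (by rwa [hz₀re]) (by rw [hz₀im]; exact ⟨hb.le, le_rfl⟩)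
    have h2 : HasDerivAt (fun y : ℂ => (x : ℂ) + y * I) I (b : ℂ) := by
      simpa using ((hasDerivAt_id (b : ℂ)).mul_const I).const_add (x : ℂ)
    exact (h1.comp (b : ℂ) h2).real_of_complex
  -- Along the vertical segment Re f is nonnegative and vanishes at y = b, so its y-derivative there
  -- is nonpositive.
  have hq0 := deriv_nonpos_of_nonneg_of_eq_zero hb hq (by
      rw [hfre, hconj z₀ hz₀im, hφs _ hz₀b.1, hz₀im, hκb, Real.cos_pi_div_two]; simp [hz₀])
    fun y hy => hmin _ (by simpa using hxa) (by simpa using ⟨hy.1.le, hy.2.le⟩)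
  have hval : ((g z₀ - g (z₀ - 2 * b * I) + K * (sinh (κ * z₀) * κ)) * I).re =
      -(2 * (g z₀).im + K * κ * Real.cosh (κ * x)) := by
    rw [mul_I_re, hconj z₀ hz₀im, hgs _ hz₀b.1, add_im, sub_im, conj_im, im_ofReal_mul,
      im_mul_ofReal, im_sinh, re_ofReal_mul, im_ofReal_mul, hz₀re, hz₀im, hκb,
      Real.sin_pi_div_two]
    ring
  rw [hval] at hq0
  have hratio := cosh_div_cosh_le (x := κ * x) (a := κ * a) (by positivity) (by
    rw [abs_mul, abs_of_pos hκ0, mul_div_assoc]; exact mul_le_mul_of_nonneg_left hx hκ0.le)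
  have e1 : K * κ * Real.cosh (κ * x) =
      Real.pi * L * (Real.cosh (κ * x) / Real.cosh (κ * a)) := by
    rw [hK, hκ]; field_simp
  have e2 : κ * a / 2 = Real.pi * a / (4 * b) := by rw [hκ]; field_simp; norm_num
  rw [e2] at hratio
  have := mul_le_mul_of_nonneg_left hratio (show 0 ≤ Real.pi * L by positivity)
  linarith

end Reflection

/-! ### The logarithm of the moment generating function -/

section CumulantBound

open Complex Metric Set

/-- The `j`-th derivative of the moment generating function `∑ p k exp (k w)` of the weights
`p 0, …, p n`. -/
noncomputable def momentSum (p : ℕ → ℝ) (n j : ℕ) (w : ℂ) : ℂ :=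
  ∑ k ∈ Finset.range (n + 1), (p k : ℂ) * (k : ℂ) ^ j * exp (k * w)

lemma hasDerivAt_momentSum (p : ℕ → ℝ) (n j : ℕ) (w : ℂ) :
    HasDerivAt (momentSum p n j) (momentSum p n (j + 1) w) w := by
  unfold momentSum
  refine HasDerivAt.fun_sum fun k _ => ?_
  have h : HasDerivAt (fun w : ℂ => (k : ℂ) * w) k w := by
    simpa using (hasDerivAt_id w).const_mul (k : ℂ)
  refine (h.cexp.const_mul ((p k : ℂ) * (k : ℂ) ^ j)).congr_deriv ?_
  ring

lemma momentSum_conj (p : ℕ → ℝ) (n j : ℕ) (w : ℂ) :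
    momentSum p n j ((starRingEnd ℂ) w) = (starRingEnd ℂ) (momentSum p n j w) := by
  simp [momentSum, map_sum, ← exp_conj]

/-- The triangle inequality; this is where nonnegativity of the weights enters. -/
lemma norm_momentSum_le {p : ℕ → ℝ} (hp : ∀ k, 0 ≤ p k) (n : ℕ) (w : ℂ) :
    ‖momentSum p n 0 w‖ ≤ ‖momentSum p n 0 w.re‖ := by
  have e : momentSum p n 0 w.re =
      ((∑ k ∈ Finset.range (n + 1), p k * Real.exp (k * w.re) : ℝ) : ℂ) := by
    simp [momentSum]
  rw [e, norm_real, Real.norm_of_nonneg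
    (Finset.sum_nonneg fun k _ => mul_nonneg (hp k) (Real.exp_pos _).le)]
  refine (norm_sum_le _ _).trans (Finset.sum_le_sum fun k _ => ?_)
  simp [norm_exp, abs_of_nonneg (hp k)]

lemma momentSum_eq_eval (p : ℕ → ℝ) (n : ℕ) (w : ℂ) :
    momentSum p n 0 w =
      (∑ k ∈ Finset.range (n + 1), Polynomial.monomial k (p k : ℂ)).eval (exp w) := by
  simp [momentSum, Polynomial.eval_finsetSum, Polynomial.eval_monomial, ← exp_nat_mul]

lemma momentSum_one_eq_eval (p : ℕ → ℝ) (n : ℕ) (w : ℂ) :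
    momentSum p n 1 w = exp w *
      (∑ k ∈ Finset.range (n + 1), Polynomial.monomial k (p k : ℂ)).derivative.eval (exp w) := by
  simp only [momentSum, Polynomial.derivative_sum, Polynomial.derivative_monomial,
    Polynomial.eval_finsetSum, Polynomial.eval_monomial, Finset.mul_sum]
  refine Finset.sum_congr rfl fun k _ => ?_
  rcases k with _ | k
  · simp
  · rw [exp_nat_mul, Nat.add_sub_cancel]
    ring

lemma norm_one_sub_exp_le {δ : ℝ} (hδ1 : δ < 1) {w : ℂ} (hw : w ∈ ball (0:ℂ) (δ / 4)) :
    ‖1 - exp w‖ ≤ δ / 2 := by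
  rw [mem_ball_zero_iff] at hw
  have := norm_exp_sub_one_le (x := w) (by linarith)
  rw [norm_sub_rev]
  linarith

lemma half_le_norm_exp_sub {δ : ℝ} (hδ1 : δ < 1) {w ζ : ℂ} (hw : w ∈ ball (0:ℂ) (δ / 4))
    (hζ : δ ≤ ‖1 - ζ‖) : δ / 2 ≤ ‖exp w - ζ‖ := by
  have h1 := norm_one_sub_exp_le hδ1 hw
  have h2 : ‖1 - ζ‖ ≤ ‖1 - exp w‖ + ‖exp w - ζ‖ := by
    refine le_trans (le_of_eq ?_) (norm_add_le _ _)
    congr 1; ring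
  linarith

lemma momentSum_ne_zero {p : ℕ → ℝ} {n : ℕ} {δ : ℝ} (hδ0 : 0 < δ) (hδ1 : δ < 1)
    (hroots : ∀ ζ : ℂ, (∑ k ∈ Finset.range (n + 1), Polynomial.monomial k (p k : ℂ)).IsRoot ζ →
      δ ≤ ‖1 - ζ‖) {w : ℂ} (hw : w ∈ ball (0:ℂ) (δ / 4)) : momentSum p n 0 w ≠ 0 := by
  intro h
  rw [momentSum_eq_eval] at h
  have h1 := hroots _ h
  have h2 := norm_one_sub_exp_le hδ1 hw
  linarith

/-- The logarithmic derivative is exp w · ∑ 1/(exp w - ζ) over at most n roots, each term at most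
2/δ, with |exp w| ≤ 3/2. -/
lemma norm_momentSum_one_div_le {p : ℕ → ℝ} {n : ℕ} {δ : ℝ} (hδ0 : 0 < δ) (hδ1 : δ < 1)
    (hroots : ∀ ζ : ℂ, (∑ k ∈ Finset.range (n + 1), Polynomial.monomial k (p k : ℂ)).IsRoot ζ →
      δ ≤ ‖1 - ζ‖) {w : ℂ} (hw : w ∈ ball (0:ℂ) (δ / 4)) :
    ‖momentSum p n 1 w / momentSum p n 0 w‖ ≤ 3 * n / δ := by
  have h0 := momentSum_ne_zero hδ0 hδ1 hroots hw
  rw [momentSum_one_eq_eval, momentSum_eq_eval, mul_div_assoc, norm_mul]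
  rw [momentSum_eq_eval] at h0
  set f := ∑ k ∈ Finset.range (n + 1), Polynomial.monomial k (p k : ℂ) with hf
  have hdeg : f.natDegree ≤ n := by
    refine Polynomial.natDegree_sum_le_of_forall_le _ _ fun k hk => ?_
    exact (Polynomial.natDegree_monomial_le _).trans (by simpa [Nat.lt_succ_iff] using hk)
  rw [(IsAlgClosed.splits f).eval_derivative_div_eval_of_ne_zero h0]
  have hsum : ‖(f.roots.map fun z => 1 / (exp w - z)).sum‖ ≤ n * (2 / δ) := by
    have h1 : ‖(f.roots.map fun z => 1 / (exp w - z)).sum‖ ≤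
        ((f.roots.map fun z => 1 / (exp w - z)).map norm).sum := norm_multiset_sum_le _
    refine h1.trans ?_
    rw [Multiset.map_map]
    refine (Multiset.sum_le_card_nsmul _ (2 / δ) fun y hy => ?_).trans ?_
    · obtain ⟨z, hz, rfl⟩ := Multiset.mem_map.1 hy
      have hz' := half_le_norm_exp_sub hδ1 hw (hroots z (Polynomial.isRoot_of_mem_roots hz))
      simp only [Function.comp, norm_div, norm_one]
      rw [div_le_div_iff₀ (by linarith) hδ0]
      linarith
    · rw [Multiset.card_map, nsmul_eq_mul]
      have : (f.roots.card : ℝ) ≤ n := by exact_mod_cast (Polynomial.card_roots' f).trans hdeg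
      exact mul_le_mul_of_nonneg_right this (by positivity)
  have hexp : ‖exp w‖ ≤ 3 / 2 := by
    have h1 := norm_one_sub_exp_le hδ1 hw
    have h2 := norm_sub_norm_le (exp w) 1
    rw [norm_sub_rev, norm_one] at h2
    linarith
  calc ‖exp w‖ * _ ≤ 3 / 2 * (n * (2 / δ)) := mul_le_mul hexp hsum (norm_nonneg _) (by norm_num)
    _ = 3 * n / δ := by ring

/-- A holomorphic logarithm of the moment generating function near `0`. -/
lemma exists_log_momentSum {p : ℕ → ℝ} {n : ℕ} {ρ : ℝ} (hρ : 0 < ρ) (h1 : momentSum p n 0 0 = 1)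
    (h0 : ∀ w ∈ ball (0:ℂ) ρ, momentSum p n 0 w ≠ 0) :
    ∃ φ : ℂ → ℂ, φ 0 = 0 ∧ (∀ w ∈ ball (0:ℂ) ρ, exp (φ w) = momentSum p n 0 w) ∧
      ∀ w ∈ ball (0:ℂ) ρ, HasDerivAt φ (momentSum p n 1 w / momentSum p n 0 w) w := by
  have hd : DifferentiableOn ℂ (fun w => momentSum p n 1 w / momentSum p n 0 w) (ball 0 ρ) :=
    fun w hw => ((hasDerivAt_momentSum p n 1 w).div (hasDerivAt_momentSum p n 0 w)
      (h0 w hw)).differentiableAt.differentiableWithinAt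
  obtain ⟨φ, hφ0, hφ⟩ := hd.isExactOn_ball.with_val_at 0 0
  refine ⟨φ, hφ0, fun w hw => ?_, hφ⟩
  -- With φ a primitive of M'/M, the quotient exp φ / M has zero derivative, hence is constantly 1.
  have hder : ∀ z ∈ ball (0:ℂ) ρ,
      HasDerivAt (fun z => exp (φ z) / momentSum p n 0 z) 0 z := by
    intro z hz
    refine ((hφ z hz).cexp.div (hasDerivAt_momentSum p n 0 z) (h0 z hz)).congr_deriv ?_
    have := h0 z hz
    field_simp
    simp
  have h2 := (convex_ball (0:ℂ) ρ).norm_image_sub_le_of_norm_hasDerivWithin_le (C := 0)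
    (fun z hz => (hder z hz).hasDerivWithinAt) (by simp) (mem_ball_self hρ) hw
  rw [zero_mul, norm_le_zero_iff, hφ0, h1, exp_zero, div_one, sub_eq_zero,
    div_eq_one_iff_eq (h0 w hw)] at h2
  exact h2

/-- **Cumulant bound.** If the generating polynomial of a probability vector on `{0, …, n}` has no
root within `δ` of `1`, then the logarithm of the moment generating function is close to its
quadratic part on a disk of radius of order `δ / log n`. -/
lemma exists_log_momentSum_approx {p : ℕ → ℝ} {n : ℕ} {δ m v : ℝ} (hn : 2 ≤ n) (hp : ∀ k, 0 ≤ p k)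
    (h1 : momentSum p n 0 0 = 1) (hm : momentSum p n 1 0 = m)
    (hv : momentSum p n 2 0 = m ^ 2 + v) (hv0 : 0 < v) (hδ0 : 0 < δ) (hδ1 : δ < 1)
    (hroots : ∀ ζ : ℂ, (∑ k ∈ Finset.range (n + 1), Polynomial.monomial k (p k : ℂ)).IsRoot ζ →
      δ ≤ ‖1 - ζ‖) (hbig : 1536 * Real.log n ≤ v * δ ^ 2) {r : ℝ}
    (hr : r = δ / (64 * Real.log n)) :
    ∃ φ : ℂ → ℂ, ∀ w : ℂ, ‖w‖ ≤ r / 2 → exp (φ w) = momentSum p n 0 w ∧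
      ‖φ w - m * w - v * w ^ 2 / 2‖ ≤ 12 * v * ‖w‖ ^ 3 / r := by
  have hρ : 0 < δ / 4 := by positivity
  have h0 : ∀ w ∈ ball (0:ℂ) (δ / 4), momentSum p n 0 w ≠ 0 := fun w hw =>
    momentSum_ne_zero hδ0 hδ1 hroots hw
  obtain ⟨φ, hφ0, hexp, hφ⟩ := exists_log_momentSum hρ h1 h0
  set g : ℂ → ℂ := fun w => momentSum p n 1 w / momentSum p n 0 w with hg
  have hlog : 0.69 ≤ Real.log n := by
    have h2 : Real.log 2 ≤ Real.log n := Real.log_le_log (by norm_num) (by exact_mod_cast hn)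
    linarith [Real.log_two_gt_d9]
  have hn0 : (0:ℝ) < n := by positivity
  have hr0 : 0 < r := by rw [hr]; positivity
  have hrδ : r ≤ δ / 44 := by
    rw [hr]
    exact div_le_div_of_nonneg_left hδ0.le (by norm_num) (by linarith)
  have hrs : r < δ / 4 := by linarith
  have hgd : ∀ w ∈ ball (0:ℂ) (δ / 4), HasDerivAt g ((momentSum p n 2 w * momentSum p n 0 w -
      momentSum p n 1 w * momentSum p n 1 w) / momentSum p n 0 w ^ 2) w := fun w hw =>
    (hasDerivAt_momentSum p n 1 w).div (hasDerivAt_momentSum p n 0 w) (h0 w hw)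
  have hgdiff : DifferentiableOn ℂ g (ball 0 (δ / 4)) := fun w hw =>
    (hgd w hw).differentiableAt.differentiableWithinAt
  have hgs : ∀ z ∈ ball (0:ℂ) (δ / 4), g ((starRingEnd ℂ) z) = (starRingEnd ℂ) (g z) := by
    intro z _
    simp only [hg, momentSum_conj, map_div₀]
  have hφre : ∀ z ∈ ball (0:ℂ) (δ / 4), Real.exp (φ z).re = ‖momentSum p n 0 z‖ := fun z hz => by
    rw [← norm_exp, hexp z hz]
  have hre : ∀ z ∈ ball (0:ℂ) (δ / 4), (φ z).re ≤ (φ z.re).re := by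
    intro z hz
    have hz' : (z.re : ℂ) ∈ ball (0:ℂ) (δ / 4) := by
      rw [mem_ball_zero_iff] at hz ⊢
      rw [norm_real]
      exact (abs_re_le_norm z).trans_lt hz
    rw [← Real.exp_le_exp, hφre z hz, hφre _ hz']
    exact norm_momentSum_le hp n z
  have hφs : ∀ z ∈ ball (0:ℂ) (δ / 4), (φ ((starRingEnd ℂ) z)).re = (φ z).re := by
    intro z hz
    have hz' : (starRingEnd ℂ) z ∈ ball (0:ℂ) (δ / 4) := by
      rwa [mem_ball_zero_iff, norm_conj, ← mem_ball_zero_iff]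
    rw [← Real.exp_eq_exp, hφre z hz, hφre _ hz', momentSum_conj, norm_conj]
  have hL : ∀ z ∈ ball (0:ℂ) (δ / 4), ‖g z‖ ≤ 3 * n / δ := fun z hz =>
    norm_momentSum_one_div_le hδ0 hδ1 hroots hz
  have him : ∀ z : ℂ, ‖z‖ = r → 0 ≤ z.im → -(12 / δ) ≤ (g z).im := by
    intro z hz hzi
    rcases hzi.eq_or_lt with hzi | hzi
    · have hzb : z ∈ ball (0:ℂ) (δ / 4) := by rwa [mem_ball_zero_iff, hz]
      have h3 := hgs z hzb
      rw [conj_eq_iff_im.2 hzi.symm] at h3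
      rw [conj_eq_iff_im.1 h3.symm]
      have : 0 < 12 / δ := by positivity
      linarith
    · have hzir : z.im ≤ r := hz ▸ (le_abs_self _).trans (abs_im_le_norm z)
      have hzre : |z.re| ≤ r := hz ▸ abs_re_le_norm z
      have key := neg_le_im_deriv_of_re_le (a := δ / 8) (b := z.im) (x := z.re) (by positivity) hzi
        (by linarith) hφ hL hre hφs hgs (by linarith)
      rw [re_add_im] at key
      -- As Im z ≤ r = δ/(64 log n), the exponent is at least log n in size, which cancels the n in
      -- the bound 3n/δ for g.
      have hE : Real.exp (-(Real.pi * (δ / 8) / (4 * z.im))) ≤ 1 / n := by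
        rw [← Real.exp_log hn0, one_div, ← Real.exp_neg, Real.exp_le_exp,
          neg_le_neg_iff, le_div_iff₀ (by positivity)]
        have h5 : Real.log n * (4 * z.im) ≤ Real.log n * (4 * r) :=
          mul_le_mul_of_nonneg_left (by linarith) (by linarith)
        have h6 : Real.log n * (4 * r) = δ / 16 := by rw [hr]; field_simp; norm_num
        have := Real.pi_gt_three
        nlinarith
      have h7 : Real.pi * (3 * n / δ) * Real.exp (-(Real.pi * (δ / 8) / (4 * z.im))) ≤ 12 / δ := by
        have := Real.pi_pos
        calc _ ≤ Real.pi * (3 * n / δ) * (1 / n) :=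
              mul_le_mul_of_nonneg_left hE (by positivity)
          _ = Real.pi * 3 / δ := by field_simp
          _ ≤ 12 / δ := by
              have := Real.pi_le_four
              gcongr
              linarith
      linarith
  have hg0 : g 0 = m := by simp only [hg]; rw [h1, hm, div_one]
  have hdg : deriv g 0 = v := by
    rw [(hgd 0 (mem_ball_self hρ)).deriv, h1, hm, hv]
    ring
  -- The error term is 24/(δr) = 1536 log n / δ², which `hbig` bounds by v.
  have hM : v + 2 * (12 / δ) / r ≤ 2 * v := by
    have : 2 * (12 / δ) / r = 1536 * Real.log n / δ ^ 2 := by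
      rw [hr]; field_simp; norm_num
    rw [this]
    have : 1536 * Real.log n / δ ^ 2 ≤ v := by rwa [div_le_iff₀ (by positivity)]
    linarith
  have happrox : ∀ w : ℂ, ‖w‖ ≤ r / 2 → ‖g w - m - v * w‖ ≤ 12 * v * ‖w‖ ^ 2 / r := by
    intro w hw
    have := norm_sub_sub_le_of_im_nonneg hr0 hrs hgdiff hgs him (by positivity) hv0 hdg hw
    rw [hg0] at this
    refine this.trans ?_
    have h3 : 6 * (v + 2 * (12 / δ) / r) ≤ 12 * v := by linarith
    gcongr
  refine ⟨φ, fun w hw => ⟨hexp w (by rw [mem_ball_zero_iff]; linarith), ?_⟩⟩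
  have hder : ∀ z ∈ closedBall (0:ℂ) ‖w‖, HasDerivWithinAt
      (fun z => φ z - m * z - v * z ^ 2 / 2) (g z - m - v * z) (closedBall (0:ℂ) ‖w‖) z := by
    intro z hz
    rw [mem_closedBall_zero_iff] at hz
    have h3 := hφ z (by rw [mem_ball_zero_iff]; linarith)
    have h4 : HasDerivAt (fun z : ℂ => (m : ℂ) * z) m z := by
      simpa using (hasDerivAt_id z).const_mul (m : ℂ)
    have h5 : HasDerivAt (fun z : ℂ => (v : ℂ) * z ^ 2 / 2) (v * z) z := by
      refine (((hasDerivAt_pow 2 z).const_mul (v : ℂ)).div_const 2).congr_deriv ?_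
      push_cast
      ring
    exact ((h3.sub h4).sub h5).hasDerivWithinAt
  have h6 := (convex_closedBall (0:ℂ) ‖w‖).norm_image_sub_le_of_norm_hasDerivWithin_le
    (C := 12 * v * ‖w‖ ^ 2 / r) hder (fun z hz => ?_)
    (mem_closedBall_self (norm_nonneg w)) (mem_closedBall_zero_iff.2 le_rfl)
  · simp only [hφ0, mul_zero, sub_zero, ne_eq, OfNat.ofNat_ne_zero, not_false_eq_true, zero_pow,
      zero_div] at h6
    refine h6.trans (le_of_eq ?_)
    ring
  · rw [mem_closedBall_zero_iff] at hz
    refine (happrox z (hz.trans hw)).trans ?_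
    gcongr

end CumulantBound

/-! ### Moments as expectations -/

lemma integral_comp_eq_sum {Ω : Type*} [MeasurableSpace Ω] (P : Measure Ω) [IsProbabilityMeasure P]
    {n : ℕ} {X : Ω → ℕ} (hX : Measurable X) (hXn : ∀ ω, X ω ≤ n) (h : ℕ → ℂ) :
    ∫ ω, h (X ω) ∂P = ∑ k ∈ Finset.range (n + 1), (P.real {ω | X ω = k} : ℂ) * h k := by
  have hm : ∀ k, MeasurableSet {ω | X ω = k} := fun k => hX (measurableSet_singleton k)
  have e : ∀ ω, h (X ω) =
      ∑ k ∈ Finset.range (n + 1), {ω | X ω = k}.indicator (fun _ => h k) ω := by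
    intro ω
    rw [Finset.sum_eq_single (X ω)]
    · simp
    · intro k _ hk
      simp [hk.symm]
    · intro hk
      exact absurd (Finset.mem_range.2 (Nat.lt_succ_of_le (hXn ω))) hk
  simp_rw [e]
  rw [integral_finsetSum _ fun k _ => (integrable_const _).indicator (hm k)]
  refine Finset.sum_congr rfl fun k _ => ?_
  rw [integral_indicator_const _ (hm k)]
  rw [Complex.real_smul]

lemma momentSum_eq_integral {Ω : Type*} [MeasurableSpace Ω] (P : Measure Ω)
    [IsProbabilityMeasure P] {n : ℕ} {X : Ω → ℕ} (hX : Measurable X) (hXn : ∀ ω, X ω ≤ n) (j : ℕ)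
    (w : ℂ) : momentSum (fun k => P.real {ω | X ω = k}) n j w =
      ∫ ω, (X ω : ℂ) ^ j * Complex.exp (X ω * w) ∂P := by
  rw [integral_comp_eq_sum P hX hXn fun k => (k : ℂ) ^ j * Complex.exp (k * w), momentSum]
  simp_rw [mul_assoc]

/-! ### Comparison with the Gaussian law -/

lemma cdf_map_mul (μ : Measure ℝ) [IsProbabilityMeasure μ] {T : ℝ} (hT : 0 < T) (x : ℝ) :
    cdf (μ.map (T * ·)) x = μ.real (Set.Iic (x / T)) := by
  have : IsProbabilityMeasure (μ.map (T * ·)) := Measure.isProbabilityMeasure_map (by fun_prop)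
  rw [cdf_eq_real, map_measureReal_apply (by fun_prop) measurableSet_Iic]
  congr 1
  ext y
  simp only [Set.mem_preimage, Set.mem_Iic]
  rw [le_div_iff₀ hT, mul_comm]

lemma gaussianReal_Iic_sub_le {x y : ℝ} (hxy : x ≤ y) :
    (gaussianReal 0 1).real (Set.Iic y) - (gaussianReal 0 1).real (Set.Iic x) ≤ y - x := by
  rw [← measureReal_sdiff (Set.Iic_subset_Iic.2 hxy) measurableSet_Iic, Set.Iic_sdiff_Iic,
    measureReal_def, gaussianReal_apply_eq_integral _ one_ne_zero,
    ENNReal.toReal_ofReal (integral_nonneg fun z => gaussianPDFReal_nonneg _ _ _)]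
  calc ∫ z in Set.Ioc x y, gaussianPDFReal 0 1 z ≤ ∫ z in Set.Ioc x y, (1:ℝ) := by
        refine setIntegral_mono_on (integrable_gaussianPDFReal _ _).integrableOn (by simp)
          measurableSet_Ioc fun z _ => ?_
        rw [gaussianPDFReal]
        refine mul_le_one₀ (inv_le_one_of_one_le₀ ?_) (Real.exp_pos _).le
          (Real.exp_le_one_iff.2 ?_)
        · rw [Real.one_le_sqrt]
          have := Real.pi_gt_three
          simp only [NNReal.coe_one]
          linarith
        · rw [neg_div]
          exact neg_nonpos.2 (by positivity)
    _ = y - x := by simp [hxy]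

/-- Esseen's smoothing inequality for the distance to the standard normal law, when the
characteristic function has an error term of cubic order. -/
lemma abs_measureReal_Iic_sub_gaussianReal_le (ν : Measure ℝ) [IsProbabilityMeasure ν] {T : ℝ}
    (hT : 0 < T) (h : ∀ t ∈ Set.Ioc 0 T, ‖charFun ν t - charFun (gaussianReal 0 1) t‖ ≤
      t ^ 3 / (4 * T) * Real.exp (-(t ^ 2 / 4))) (x : ℝ) :
    |ν.real (Set.Iic x) - (gaussianReal 0 1).real (Set.Iic x)| ≤ 132 / T := by
  have h1 : IsProbabilityMeasure (ν.map (T * ·)) := Measure.isProbabilityMeasure_map (by fun_prop)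
  have h2 : IsProbabilityMeasure ((gaussianReal 0 1).map (T * ·)) :=
    Measure.isProbabilityMeasure_map (by fun_prop)
  have hb : 0 < T ^ 2 / 8 := by positivity
  -- Scaling by T moves the cutoff to 1 and makes the Gaussian 1/T-Lipschitz. With s = Tt, s³/(4T) =
  -- 2t · s²/8, and s²/8 ≤ exp(s²/8) is absorbed by half of the decay exp(-s²/4).
  have key := abs_cdf_sub_cdf_le (ν.map (T * ·)) ((gaussianReal 0 1).map (T * ·))
    (β := fun t => 2 * Real.exp (-(T ^ 2 / 8) * t ^ 2)) (m := 1 / T)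
    (Continuous.intervalIntegrable (by fun_prop) _ _) (fun t ht => ?_) (fun y z hyz => ?_) (T * x)
  · rw [cdf_map_mul _ hT, cdf_map_mul _ hT, mul_div_cancel_left₀ _ hT.ne'] at key
    have hJ : ∫ t in (0:ℝ)..1, 2 * Real.exp (-(T ^ 2 / 8) * t ^ 2) ≤ 6 / T := by
      rw [intervalIntegral.integral_const_mul, intervalIntegral.integral_of_le zero_le_one]
      have h3 : ∫ t in Set.Ioc (0:ℝ) 1, Real.exp (-(T ^ 2 / 8) * t ^ 2) ≤
          ∫ t in Set.Ioi (0:ℝ), Real.exp (-(T ^ 2 / 8) * t ^ 2) :=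
        setIntegral_mono_set (integrable_exp_neg_mul_sq hb).integrableOn
          (ae_of_all _ fun t => (Real.exp_pos _).le) Set.Ioc_subset_Ioi_self.eventuallyLE
      rw [integral_gaussian_Ioi] at h3
      have h4 : √(Real.pi / (T ^ 2 / 8)) ≤ 6 / T := by
        rw [Real.sqrt_le_left (by positivity), div_pow, div_le_div_iff₀ hb (by positivity)]
        have := Real.pi_le_four
        nlinarith [sq_nonneg T]
      linarith
    have e : 132 / T = 96 * (1 / T) + 6 * (6 / T) := by ring
    linarith
  · rw [charFun_map_mul, charFun_map_mul]
    refine (h (T * t) ⟨mul_pos hT ht.1, mul_le_of_le_one_right hT.le ht.2⟩).trans ?_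
    have h3 : (T * t) ^ 2 / 8 ≤ Real.exp ((T * t) ^ 2 / 8) := by
      linarith [Real.add_one_le_exp ((T * t) ^ 2 / 8)]
    have h4 : Real.exp ((T * t) ^ 2 / 8) * Real.exp (-((T * t) ^ 2 / 4)) =
        Real.exp (-(T ^ 2 / 8) * t ^ 2) := by
      rw [← Real.exp_add]; congr 1; ring
    have h5 := mul_le_mul_of_nonneg_right h3 (Real.exp_pos (-((T * t) ^ 2 / 4))).le
    rw [h4] at h5
    have h6 := mul_le_mul_of_nonneg_left h5 (show 0 ≤ 2 * t by linarith [ht.1])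
    calc _ = 2 * t * ((T * t) ^ 2 / 8 * Real.exp (-((T * t) ^ 2 / 4))) := by
          field_simp; ring
      _ ≤ _ := h6
      _ = _ := by ring
  · rw [cdf_map_mul _ hT, cdf_map_mul _ hT]
    refine (gaussianReal_Iic_sub_le (div_le_div_of_nonneg_right hyz hT.le)).trans (le_of_eq ?_)
    ring

/-- Factor out exp(-s²/2) and use |exp u - 1| ≤ |u| exp|u|; the bound on B costs only half of the
Gaussian exponent. -/
lemma norm_exp_sub_exp_le {s B : ℝ} {z : ℂ} (hz : ‖z + s ^ 2 / 2‖ ≤ B) (hB : B ≤ s ^ 2 / 4) :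
    ‖Complex.exp z - Complex.exp (-(s ^ 2 / 2))‖ ≤ B * Real.exp (-(s ^ 2 / 4)) := by
  have e : Complex.exp z - Complex.exp (-(s ^ 2 / 2)) =
      Complex.exp (-(s ^ 2 / 2)) * (Complex.exp (z + s ^ 2 / 2) - 1) := by
    rw [mul_sub, ← Complex.exp_add, mul_one]
    congr 2
    ring
  have e1 : ‖Complex.exp (-((s:ℂ) ^ 2 / 2))‖ = Real.exp (-(s ^ 2 / 2)) := by
    rw [← Complex.norm_of_nonneg (Real.exp_pos (-(s ^ 2 / 2))).le]
    push_cast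
    rfl
  have e2 : ‖Complex.exp (z + s ^ 2 / 2) - 1‖ ≤ B * Real.exp (s ^ 2 / 4) := by
    have h := Complex.norm_exp_sub_sum_le_norm_mul_exp (z + s ^ 2 / 2) 1
    simp only [Finset.sum_range_one, pow_zero, Nat.factorial_zero, Nat.cast_one, div_one,
      pow_one] at h
    refine h.trans ?_
    exact mul_le_mul hz (Real.exp_le_exp.2 (hz.trans hB)) (Real.exp_pos _).le
      ((norm_nonneg _).trans hz)
  rw [e, norm_mul, e1]
  calc _ ≤ Real.exp (-(s ^ 2 / 2)) * (B * Real.exp (s ^ 2 / 4)) :=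
        mul_le_mul_of_nonneg_left e2 (Real.exp_pos _).le
    _ = B * (Real.exp (-(s ^ 2 / 2)) * Real.exp (s ^ 2 / 4)) := by ring
    _ = _ := by rw [← Real.exp_add]; congr 2; ring

/-! ### The normalized variable and the main theorem -/

lemma measurable_normalized {Ω : Type*} [MeasurableSpace Ω] (P : Measure Ω) {X : Ω → ℕ}
    (hX : Measurable X) : Measurable (normalized P X) :=
  ((measurable_from_nat.comp hX).sub_const _).div_const _

lemma charFun_normalized {Ω : Type*} [MeasurableSpace Ω] (P : Measure Ω) [IsProbabilityMeasure P]
    {n : ℕ} {X : Ω → ℕ} (hX : Measurable X) (hXn : ∀ ω, X ω ≤ n) (t : ℝ) :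
    charFun (P.map (normalized P X)) t =
      momentSum (fun k => P.real {ω | X ω = k}) n 0 (t / stdDev P X * Complex.I) *
        Complex.exp (-(mean P X * (t / stdDev P X * Complex.I))) := by
  have hm : Measurable (normalized P X) := measurable_normalized P hX
  rw [charFun_apply_real, integral_map hm.aemeasurable (by fun_prop),
    momentSum_eq_integral P hX hXn, ← integral_mul_const]
  refine integral_congr_ae (ae_of_all _ fun ω => ?_)
  simp only [pow_zero, one_mul]
  rw [← Complex.exp_add]
  congr 1
  simp only [normalized]
  push_cast
  ring

lemma integral_sq_eq {Ω : Type*} [MeasurableSpace Ω] (P : Measure Ω) [IsProbabilityMeasure P]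
    {n : ℕ} {X : Ω → ℕ} (hX : Measurable X) (hXn : ∀ ω, X ω ≤ n) :
    ∫ ω, (X ω : ℝ) ^ 2 ∂P = mean P X ^ 2 + stdDev P X ^ 2 := by
  have hL : MemLp (fun ω => (X ω : ℝ)) 2 P := by
    refine MemLp.of_bound (measurable_from_nat.comp hX).aestronglyMeasurable n
      (ae_of_all _ fun ω => ?_)
    simpa using hXn ω
  rw [stdDev, Real.sq_sqrt (variance_nonneg _ _), variance_eq_sub hL, mean]
  simp only [Pi.pow_apply]
  ring

lemma kolmogorovDist_le {ν₁ ν₂ : Measure ℝ} {C : ℝ}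
    (h : ∀ x, |ν₁.real (Set.Iic x) - ν₂.real (Set.Iic x)| ≤ C) : kolmogorovDist ν₁ ν₂ ≤ C :=
  ciSup_le h

theorem theorem1 {Ω : Type*} [MeasurableSpace Ω] (P : Measure Ω) [IsProbabilityMeasure P]
    (n : ℕ) (hn : 2 ≤ n) (X : Ω → ℕ) (hX : Measurable X) (hXn : ∀ ω, X ω ≤ n)
    (hσ : 0 < stdDev P X) (δ : ℝ) (hδ0 : 0 < δ) (hδ1 : δ < 1)
    (hroots : ∀ ζ : ℂ, (pgf P n X).IsRoot ζ → δ ≤ ‖1 - ζ‖) :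
    kolmogorovDist (P.map (normalized P X)) (gaussianReal 0 1) ≤
      2 ^ 3261 * (Real.log n / (δ * stdDev P X)) := by
  have hm : Measurable (normalized P X) := measurable_normalized P hX
  have hν : IsProbabilityMeasure (P.map (normalized P X)) :=
    Measure.isProbabilityMeasure_map hm.aemeasurable
  set σ := stdDev P X with hσdef
  set ν := P.map (normalized P X) with hνdef
  have hlog : 0.69 ≤ Real.log n := by
    have h2 : Real.log 2 ≤ Real.log n := Real.log_le_log (by norm_num) (by exact_mod_cast hn)
    linarith [Real.log_two_gt_d9]
  have hδσ : 0 < δ * σ := mul_pos hδ0 hσ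
  -- The argument gives the constant 2^20, far below the stated one.
  suffices hmain : kolmogorovDist ν (gaussianReal 0 1) ≤ 2 ^ 20 * (Real.log n / (δ * σ)) by
    refine hmain.trans (mul_le_mul_of_nonneg_right
      (pow_le_pow_right₀ (by norm_num) (by norm_num)) ?_)
    exact div_nonneg (by linarith) hδσ.le
  refine kolmogorovDist_le fun x => ?_
  rcases le_or_gt (δ * σ) (2 ^ 20 * Real.log n) with hsmall | hbig
  -- Here the bound exceeds 1 and is trivial; otherwise δσ is large enough for the cumulant bound.
  · have h1 : 1 ≤ 2 ^ 20 * (Real.log n / (δ * σ)) := by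
      rw [← mul_div_assoc, le_div_iff₀ hδσ]
      linarith
    refine le_trans ?_ h1
    have h2 := measureReal_le_one (μ := ν) (s := Set.Iic x)
    have h3 := measureReal_le_one (μ := gaussianReal 0 1) (s := Set.Iic x)
    have h4 := measureReal_nonneg (μ := ν) (s := Set.Iic x)
    have h5 := measureReal_nonneg (μ := gaussianReal 0 1) (s := Set.Iic x)
    rw [abs_le]
    constructor <;> linarith
  set r := δ / (64 * Real.log n) with hr
  have hr0 : 0 < r := by positivity
  have hm1 : momentSum (fun k => P.real {ω | X ω = k}) n 0 0 = 1 := by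
    rw [momentSum_eq_integral P hX hXn]
    simp
  have hm2 : momentSum (fun k => P.real {ω | X ω = k}) n 1 0 = mean P X := by
    rw [momentSum_eq_integral P hX hXn, mean, ← integral_complex_ofReal]
    simp
  have hm3 : momentSum (fun k => P.real {ω | X ω = k}) n 2 0 =
      (mean P X : ℂ) ^ 2 + (σ ^ 2 : ℝ) := by
    rw [momentSum_eq_integral P hX hXn, ← Complex.ofReal_pow, ← Complex.ofReal_add,
      ← integral_sq_eq P hX hXn, ← integral_complex_ofReal]
    simp
  obtain ⟨φ, hφ⟩ := exists_log_momentSum_approx (p := fun k => P.real {ω | X ω = k})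
    (v := σ ^ 2) (r := r) hn (fun k => measureReal_nonneg) hm1 hm2 hm3 (by positivity) hδ0 hδ1
    hroots (by nlinarith) hr
  -- At w = it/σ the cubic error is 12t³/(rσ) = t³/(4T), and it is at most t²/4 exactly when t ≤ T.
  have hT : 0 < r * σ / 48 := by positivity
  refine (abs_measureReal_Iic_sub_gaussianReal_le ν hT (fun t ht => ?_) x).trans (le_of_lt ?_)
  · set w : ℂ := t / σ * Complex.I with hw
    have hwn : ‖w‖ = t / σ := by
      rw [hw, ← Complex.ofReal_div, norm_mul, Complex.norm_I, mul_one, Complex.norm_real,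
        Real.norm_of_nonneg (div_nonneg ht.1.le hσ.le)]
    have hw2 : (σ : ℂ) ^ 2 * w ^ 2 = -(t : ℂ) ^ 2 := by
      have : (σ : ℂ) ≠ 0 := by exact_mod_cast hσ.ne'
      rw [hw, mul_pow, Complex.I_sq]
      field_simp
    have ht2 := ht.2
    have hrσ : 0 < r * σ := mul_pos hr0 hσ
    obtain ⟨h1, h2⟩ := hφ w (by
      rw [hwn, div_le_div_iff₀ hσ two_pos]
      linarith)
    have h3 : charFun ν t = Complex.exp (φ w - mean P X * w) := by
      rw [hνdef, charFun_normalized P hX hXn, ← hσdef, ← hw, ← h1, ← Complex.exp_add, sub_eq_add_neg]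
    have h4 : charFun (gaussianReal 0 1) t = Complex.exp (-((t : ℂ) ^ 2 / 2)) := by
      rw [charFun_gaussianReal]
      congr 1
      simp
    rw [h3, h4]
    refine norm_exp_sub_exp_le ?_ ?_
    · have e : φ w - mean P X * w + (t : ℂ) ^ 2 / 2 =
          φ w - mean P X * w - (σ ^ 2 : ℝ) * w ^ 2 / 2 := by
        push_cast
        rw [hw2]
        ring
      rw [e]
      refine h2.trans (le_of_eq ?_)
      rw [hwn]
      field_simp
      ring
    · rw [div_le_div_iff₀ (by positivity) (by norm_num)]
      nlinarith [mul_le_mul_of_nonneg_left ht2 (sq_nonneg t)]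
  · have e : 132 / (r * σ / 48) = 405504 * (Real.log n / (δ * σ)) := by
      rw [hr]; field_simp; norm_num
    rw [e]
    refine mul_lt_mul_of_pos_right (by norm_num) (by positivity)
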